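/- Let $\mathcal{C}$ be a small category with finite products and finite coproducts. A presheaf $P : \mathcal{C}^{\mathrm{op}} \to \mathbf{Set}$ is \emph{product-preserving} if it preserves the finite products of $\mathcal{C}^{\mathrm{op}}$ (i.e. sends finite coproducts of $\mathcal{C}$ to products of sets). Let $\mathrm{Fun}_\times(\mathcal{C}^{\mathrm{op}}, \mathbf{Set})$ be the full subcategory of presheaves on the product-preserving ones, let $y : \mathcal{C} \to \mathrm{Fun}_\times(\mathcal{C}^{\mathrm{op}}, \mathbf{Set})$ be the Yoneda embedding, and let $\mathrm{Sind}(\mathcal{C})$ be the sifted completion of $\mathcal{C}$, i.e. the full subcategory of presheaves on the small sifted colimits of representables. Then $\mathrm{Sind}(\mathcal{C}) = \mathrm{Fun}_\times(\mathcal{C}^{\mathrm{op}}, \mathbf{Set})$, and the following are equivalent: (i) $\mathcal{C}$ is distributive: for all objects $a, b, c$ the canonical morphism $(a \times b) + (a \times c) \to a \times (b + c)$ is an isomorphism. (ii) For all product-preserving presheaves $P$ and all objects $a, b$ of $\mathcal{C}$, $P \times y(a+b) \cong P \times y(a) + P \times y(b)$ canonically in $\mathrm{Fun}_\times(\mathcal{C}^{\mathrm{op}},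 \mathbf{Set})$; that is, the morphisms $P \times y(a) \to P \times y(a+b) \leftarrow P \times y(b)$ induced by the coproduct injections of $a+b$ form a coproduct diagram in $\mathrm{Fun}_\times(\mathcal{C}^{\mathrm{op}}, \mathbf{Set})$. (iii) $\mathrm{Sind}(\mathcal{C}) = \mathrm{Fun}_\times(\mathcal{C}^{\mathrm{op}}, \mathbf{Set})$ is cartesian closed. In that case $y$ preserves exponentials: if $\mathrm{ev} : a \times e \to b$ exhibits $e$ as an exponential $b^a$ in $\mathcal{C}$, then the composite $y(a) \times y(e) \cong y(a \times e) \to y(b)$ exhibits $y(e)$ as an exponential $y(b)^{y(a)}$ in $\mathrm{Fun}_\times(\mathcal{C}^{\mathrm{op}}, \mathbf{Set})$. -/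

import Mathlib

open CategoryTheory CategoryTheory.Limits Opposite

universe u

namespace SiftedCCC

/-- Evaluating at `j`, a limit of functors preserving limits of shape `K` preserves them. -/
theorem preservesLimitsOfShape_of_presentation {J : Type*} [Category* J] {K K' : Type}
    [Category.{0} K] [Category.{0} K'] {G : J ⥤ Type u}
    (h : (ObjectProperty.preservesLimitsOfShape (J := J) (C := Type u) K).LimitOfShape K' G) :
    PreservesLimitsOfShape K G := by
  have := h.prop_diag_obj
  have : PreservesLimitsOfShape K h.diag.flip := ⟨fun {F} ↦ ⟨fun {c} hc ↦
    ⟨evaluationJointlyReflectsLimits _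
      (fun k' ↦ isLimitOfPreserves (h.diag.obj k') hc)⟩⟩⟩
  let e : G ≅ h.diag.flip ⋙ lim :=
    NatIso.ofComponents
      (fun j ↦ (isLimitOfPreserves ((evaluation _ _).obj j) h.isLimit).conePointUniqueUpToIso
        (limit.isLimit (h.diag.flip.obj j)))
      (fun {X Y} f ↦ by
        refine limit.hom_ext fun k ↦ ?_
        have h₁ := fun j ↦ IsLimit.conePointUniqueUpToIso_hom_comp
          (isLimitOfPreserves ((evaluation _ _).obj j) h.isLimit)
          (limit.isLimit (h.diag.flip.obj j)) k
        have h₂ := h₁ X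
        have h₃ := h₁ Y
        dsimp at h₂ h₃ ⊢
        simp only [Category.assoc, limMap_π]
        erw [h₃, reassoc_of% h₂]
        exact (h.π.app k).naturality f)
  exact preservesLimitsOfShape_of_natIso e.symm

section

variable (C : Type u) [SmallCategory C]

/-- The property of a presheaf `P : Cᵒᵖ ⥤ Type u` of preserving finite products. As finite products
in `Cᵒᵖ` are finite coproducts in `C`, such a `P` sends finite coproducts of `C` to products. -/
def productPreserving : ObjectProperty (Cᵒᵖ ⥤ Type u) :=
  fun P => PreservesFiniteProducts P

/-- Product-preserving presheaves and all natural transformations between them. -/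
abbrev PPPsh : Type (u + 1) := (productPreserving C).FullSubcategory

/-- The presheaves that are small sifted colimits of representable presheaves. The full subcategory
that they span is the sifted completion of `C`. -/
def siftedCompletion : ObjectProperty (Cᵒᵖ ⥤ Type u) :=
  fun P => ∃ (I : Type u) (_ : SmallCategory I) (_ : IsSifted I) (F : I ⥤ C)
    (ι : F ⋙ yoneda ⟶ (Functor.const I).obj P), Nonempty (IsColimit (Cocone.mk P ι))

instance (K : Type) [Category.{0} K] :
    (productPreserving C).IsClosedUnderLimitsOfShape K where
  limitsOfShape_le := by
    rintro G ⟨h⟩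
    refine ⟨fun n => preservesLimitsOfShape_of_presentation (K' := K)
      { toLimitPresentation := h.toLimitPresentation
        prop_diag_obj := fun j => ?_ }⟩
    have : PreservesFiniteProducts (h.diag.obj j) := h.prop_diag_obj j
    exact (inferInstance : PreservesLimitsOfShape (Discrete (Fin n)) (h.diag.obj j))

/-- The Yoneda embedding into product-preserving presheaves. -/
def yo : C ⥤ PPPsh C :=
  (productPreserving C).lift yoneda fun c =>
    (inferInstance : PreservesFiniteProducts (yoneda.obj c))

instance : PreservesFiniteProducts (yo C) := by
  have : PreservesLimitsOfSize.{0, 0} (yo C ⋙ (productPreserving C).ι) :=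
    (inferInstance : PreservesLimitsOfSize.{0, 0} (yoneda (C := C)))
  exact ⟨fun n => preservesLimitsOfShape_of_reflects_of_preserves _ (productPreserving C).ι⟩

end

open MonoidalCategory CartesianMonoidalCategory

/-- In a category with finite products, `ev : a × e ⟶ b` exhibits `e` as the exponential `b ^ a`:
every `f : a × x ⟶ b` is `ev ∘ (a × g)` for a unique `g : x ⟶ e`. -/
def IsExponential {D : Type*} [Category* D] [CartesianMonoidalCategory D] {a b e : D}
    (ev : a ⊗ e ⟶ b) : Prop :=
  ∀ ⦃x : D⦄ (f : a ⊗ x ⟶ b), ∃! g : x ⟶ e, a ◁ g ≫ ev = f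

/-- `F` preserves exponentials: if `ev` exhibits `e` as `b ^ a`, then the composite
`F a × F e ≅ F (a × e) ⟶ F b` exhibits `F e` as the exponential `(F b) ^ (F a)`. -/
def PreservesExponentials {D E : Type*} [Category* D] [Category* E] [CartesianMonoidalCategory D]
    [CartesianMonoidalCategory E] (F : D ⥤ E) [PreservesFiniteProducts F] : Prop :=
  ∀ ⦃a b e : D⦄ (ev : a ⊗ e ⟶ b), IsExponential ev →
    IsExponential ((prodComparisonIso F a e).inv ≫ F.map ev)

end SiftedCCC

open MonoidalCategory SiftedCCC

/-! Sifted colimits of sets commute with finite products and representables preserve them, so sifted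
colimits of representables do too; conversely, a product-preserving presheaf has a sifted category
of elements. Mapping out of `y(a+b)` into a product-preserving `Q` amounts to choosing an element of
`Q(a+b) ≅ Q(a) × Q(b)`, so `y` preserves coproducts. If products have right adjoints, (ii) follows.
Conversely, by Yoneda the presheaf exponential `Q^P` is `Hom(P × y(-), Q)`, which (ii) makes
product-preserving, so exponentials of presheaves restrict. For (ii) ⇒ (i), take `P` representable
and reflect along `y`. For (i) ⇒ (ii), a map `P × y(c) ⟶ Q` is determined by its values at generic
elements, which lie in `Q(x × c)` and are glued from `Q(x × a)` and `Q(x × b)`. -/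

namespace SiftedCCC

open CartesianMonoidalCategory

/-! ### Sifted colimits of representables -/

section Sifted

variable {C : Type u} [SmallCategory C]

/-- A sifted colimit of representable presheaves preserves finite products. -/
theorem productPreserving_of_siftedCompletion {P : Cᵒᵖ ⥤ Type u} (h : siftedCompletion C P) :
    productPreserving C P := by
  obtain ⟨I, _, _, F, ι, ⟨hc⟩⟩ := h
  have (n : ℕ) : PreservesLimitsOfShape (Discrete (Fin n)) (F ⋙ yoneda).flip :=
    ⟨fun {K} ↦ ⟨fun {c} hK ↦ ⟨evaluationJointlyReflectsLimits _
      (fun i ↦ isLimitOfPreserves (yoneda.obj (F.obj i)) hK)⟩⟩⟩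
  let e : (F ⋙ yoneda).flip ⋙ colim ≅ P :=
    (colimitIsoFlipCompColim (F ⋙ yoneda)).symm ≪≫
      (colimit.isColimit (F ⋙ yoneda)).coconePointUniqueUpToIso hc
  exact ⟨fun n ↦ preservesLimitsOfShape_of_natIso e⟩

/-- A product-preserving presheaf is the colimit of representables over its category of elements,
which is sifted as it has finite coproducts. -/
theorem siftedCompletion_of_productPreserving [HasFiniteCoproducts C] {P : Cᵒᵖ ⥤ Type u}
    (h : productPreserving C P) : siftedCompletion C P := by
  have : PreservesFiniteProducts P := h
  -- As `P` preserves finite products, those of `Cᵒᵖ` lift to its elements.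
  have : _root_.Nonempty P.Elements := ⟨(⊤_ P.Elements)⟩
  have : IsSifted P.Elementsᵒᵖ := inferInstance
  have : IsSifted (CostructuredArrow yoneda P) :=
    IsSifted.isSifted_of_equiv (CategoryOfElements.costructuredArrowYonedaEquivalence P).symm
  exact ⟨CostructuredArrow yoneda P, inferInstance, this, CostructuredArrow.proj yoneda P,
    (Presheaf.tautologicalCocone P).ι, ⟨Presheaf.isColimitTautologicalCocone P⟩⟩

end Sifted

/-! ### Coproducts of representables and their products with a presheaf -/

section Coproducts

variable {C : Type u} [SmallCategory C]

/-- A product-preserving presheaf sends coproducts to products, elementwise. -/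
theorem existsUnique_glue {P : Cᵒᵖ ⥤ Type u} (hP : productPreserving C P) {a b c : C}
    {i : a ⟶ c} {j : b ⟶ c} (hc : IsColimit (BinaryCofan.mk i j))
    (x : P.obj (op a)) (y : P.obj (op b)) :
    ∃! z : P.obj (op c), P.map i.op z = x ∧ P.map j.op z = y := by
  have : PreservesFiniteProducts P := hP
  have : PreservesLimitsOfShape (Discrete WalkingPair) P := inferInstance
  have hl : IsLimit (BinaryFan.mk i.op j.op) := BinaryCofan.IsColimit.op hc
  have hl := mapIsLimitOfPreservesOfIsLimit P _ _ hl
  let e : P.obj (op c) ≃ P.obj (op a) × P.obj (op b) := (hl.conePointUniqueUpToIso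
    (Types.binaryProductLimit (P.obj (op a)) (P.obj (op b)))).toEquiv
  have he (z) : e z = (P.map i.op z, P.map j.op z) := rfl
  refine ⟨e.symm (x, y), ?_, fun z hz ↦ ?_⟩
  · have h := he (e.symm (x, y))
    rw [e.apply_symm_apply, Prod.mk.injEq] at h
    exact ⟨h.1.symm, h.2.symm⟩
  · rw [e.eq_symm_apply, he, hz.1, hz.2]

/-- The Yoneda lemma for product-preserving presheaves. -/
def yoHomEquiv {c : C} {Q : PPPsh C} : ((yo C).obj c ⟶ Q) ≃ Q.obj.obj (op c) :=
  ((productPreserving C).fullyFaithfulι.homEquiv (X := (yo C).obj c) (Y := Q)).trans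
    (yonedaEquiv (X := c) (F := Q.obj))

theorem map_yoHomEquiv {c d : C} {Q : PPPsh C} (k : d ⟶ c) (h : (yo C).obj c ⟶ Q) :
    Q.obj.map k.op (yoHomEquiv h) = yoHomEquiv ((yo C).map k ≫ h) :=
  yonedaEquiv_naturality (F := Q.obj) h.hom k

/-- The Yoneda embedding into product-preserving presheaves preserves binary coproducts. -/
theorem isColimit_yo {a b c : C} {i : a ⟶ c} {j : b ⟶ c}
    (hc : IsColimit (BinaryCofan.mk i j)) :
    Nonempty (IsColimit (BinaryCofan.mk ((yo C).map i) ((yo C).map j))) := by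
  have key {Q : PPPsh C} (f : (yo C).obj a ⟶ Q) (g : (yo C).obj b ⟶ Q) :
      ∃! h : (yo C).obj c ⟶ Q, (yo C).map i ≫ h = f ∧ (yo C).map j ≫ h = g := by
    have h := existsUnique_glue Q.property hc (yoHomEquiv f) (yoHomEquiv g)
    rw [yoHomEquiv.bijective.existsUnique_iff] at h
    simpa only [map_yoHomEquiv, yoHomEquiv.apply_eq_iff_eq] using h
  exact ⟨BinaryCofan.isColimitMk (fun s ↦ (key s.inl s.inr).choose)
    (fun s ↦ (key s.inl s.inr).choose_spec.1.1) (fun s ↦ (key s.inl s.inr).choose_spec.1.2)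
    (fun s m h₁ h₂ ↦ (key s.inl s.inr).choose_spec.2 m ⟨h₁, h₂⟩)⟩

/-- The Yoneda embedding into product-preserving presheaves preserves initial objects. -/
theorem exists_hom_yo_of_isInitial {c : C} (hc : IsInitial c) (Q : PPPsh C) :
    Nonempty ((yo C).obj c ⟶ Q) := by
  have : PreservesFiniteProducts Q.obj := Q.property
  have hl : IsTerminal (Q.obj.obj (op c)) :=
    IsTerminal.isTerminalObj Q.obj _ (terminalOpOfInitial hc)
  exact ⟨yoHomEquiv.symm (hl.from PUnit PUnit.unit)⟩

/-- The value of a morphism `P × y(c) ⟶ Q` at an element of `P` and an element of `y(c)`. -/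
def evalPair {P Q : PPPsh C} {c : C} (f : P ⊗ (yo C).obj c ⟶ Q) {x : C} (p : P.obj.obj (op x))
    (s : x ⟶ c) : Q.obj.obj (op x) :=
  f.hom.app (op x) (p, s)

theorem map_evalPair {P Q : PPPsh C} {c : C} (f : P ⊗ (yo C).obj c ⟶ Q) {x y : C} (k : y ⟶ x)
    (p : P.obj.obj (op x)) (s : x ⟶ c) :
    Q.obj.map k.op (evalPair f p s) = evalPair f (P.obj.map k.op p) (k ≫ s) :=
  (NatTrans.naturality_apply f.hom k.op _).symm

theorem evalPair_whiskerLeft_comp {P Q : PPPsh C} {a c : C} (i : a ⟶ c)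
    (f : P ⊗ (yo C).obj c ⟶ Q) {x : C} (p : P.obj.obj (op x)) (s : x ⟶ a) :
    evalPair (P ◁ (yo C).map i ≫ f) p s = evalPair f p (s ≫ i) :=
  rfl

theorem hom_ext_evalPair {P Q : PPPsh C} {c : C} {f g : P ⊗ (yo C).obj c ⟶ Q}
    (h : ∀ ⦃x : C⦄ (p : P.obj.obj (op x)) (s : x ⟶ c), evalPair f p s = evalPair g p s) :
    f = g := by
  refine InducedCategory.hom_ext (NatTrans.ext (funext fun x ↦ ?_))
  ext ⟨p, s⟩
  exact h (x := x.unop) p s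

/-- A morphism `P × y(c) ⟶ Q` from its values. -/
def homOfEvalPair {P Q : PPPsh C} {c : C}
    (φ : ∀ ⦃x : C⦄, P.obj.obj (op x) → (x ⟶ c) → Q.obj.obj (op x))
    (hφ : ∀ ⦃x y : C⦄ (k : y ⟶ x) (p : P.obj.obj (op x)) (s : x ⟶ c),
      Q.obj.map k.op (φ p s) = φ (P.obj.map k.op p) (k ≫ s)) :
    P ⊗ (yo C).obj c ⟶ Q :=
  ObjectProperty.homMk
    { app x := ↾fun (t : P.obj.obj x × (x.unop ⟶ c)) ↦ φ (x := x.unop) t.1 t.2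
      naturality x y k := by
        ext ⟨p, s⟩
        exact (hφ k.unop p s).symm }

theorem evalPair_homOfEvalPair {P Q : PPPsh C} {c : C}
    (φ : ∀ ⦃x : C⦄, P.obj.obj (op x) → (x ⟶ c) → Q.obj.obj (op x)) (hφ) {x : C}
    (p : P.obj.obj (op x)) (s : x ⟶ c) : evalPair (homOfEvalPair φ hφ) p s = φ p s :=
  rfl

/-- If `x × -` preserves the coproduct `c` of `a` and `b` for all `x`, then `P × -` preserves its
image under the Yoneda embedding. -/
theorem isColimit_whiskerLeft_yo [CartesianMonoidalCategory C] {a b c : C} {i : a ⟶ c} {j : b ⟶ c}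
    (hc : ∀ x : C, Nonempty (IsColimit (BinaryCofan.mk (x ◁ i) (x ◁ j)))) (P : PPPsh C) :
    Nonempty (IsColimit (BinaryCofan.mk (P ◁ (yo C).map i) (P ◁ (yo C).map j))) := by
  have key {Q : PPPsh C} (f : P ⊗ (yo C).obj a ⟶ Q) (g : P ⊗ (yo C).obj b ⟶ Q) :
      ∃! h : P ⊗ (yo C).obj c ⟶ Q, P ◁ (yo C).map i ≫ h = f ∧ P ◁ (yo C).map j ≫ h = g := by
    -- `q x p` is the value that the sought map must take at the generic pair over `x × c`: `p`
    -- pulled back along the first projection, and the second projection.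
    have glue (x : C) (p : P.obj.obj (op x)) := existsUnique_glue Q.property (hc x).some
      (evalPair f (P.obj.map (fst x a).op p) (snd x a))
      (evalPair g (P.obj.map (fst x b).op p) (snd x b))
    choose q hq hu using glue
    have map_map {R : PPPsh C} {x y z : C} (k : y ⟶ x) (l : z ⟶ y) (r : R.obj.obj (op x)) :
        R.obj.map l.op (R.obj.map k.op r) = R.obj.map (l ≫ k).op r := by simp
    have nat {x y : C} (k : y ⟶ x) (p : P.obj.obj (op x)) :
        Q.obj.map (k ▷ c).op (q x p) = q y (P.obj.map k.op p) := by
      refine hu _ _ _ ⟨?_, ?_⟩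
      · rw [map_map, whisker_exchange, ← map_map, (hq x p).1, map_evalPair, map_map, map_map,
          whiskerRight_fst, whiskerRight_snd]
      · rw [map_map, whisker_exchange, ← map_map, (hq x p).2, map_evalPair, map_map, map_map,
          whiskerRight_fst, whiskerRight_snd]
    -- The pair `(p, s)` is the pullback of the generic one along the graph of `s`.
    refine ⟨homOfEvalPair (fun x p s ↦ Q.obj.map (lift (𝟙 x) s).op (q x p)) ?_,
      ⟨?_, ?_⟩, fun h hh ↦ ?_⟩
    · intro x y k p s
      have e : k ≫ lift (𝟙 x) s = lift (𝟙 y) (k ≫ s) ≫ k ▷ c := by simp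
      rw [← nat, map_map, map_map, e]
    · refine hom_ext_evalPair fun x p s ↦ ?_
      have e : lift (𝟙 x) (s ≫ i) = lift (𝟙 x) s ≫ x ◁ i := by simp
      rw [evalPair_whiskerLeft_comp, evalPair_homOfEvalPair, e, ← map_map, (hq x p).1,
        map_evalPair, map_map, lift_fst, lift_snd, op_id, CategoryTheory.Functor.map_id,
          ConcreteCategory.id_apply]
    · refine hom_ext_evalPair fun x p s ↦ ?_
      have e : lift (𝟙 x) (s ≫ j) = lift (𝟙 x) s ≫ x ◁ j := by simp
      rw [evalPair_whiskerLeft_comp, evalPair_homOfEvalPair, e, ← map_map, (hq x p).2,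
        map_evalPair, map_map, lift_fst, lift_snd, op_id, CategoryTheory.Functor.map_id,
          ConcreteCategory.id_apply]
    · have e {x : C} (p : P.obj.obj (op x)) :
          evalPair h (P.obj.map (fst x c).op p) (snd x c) = q x p := by
        refine hu _ _ _ ⟨?_, ?_⟩
        · rw [map_evalPair, map_map, whiskerLeft_fst, whiskerLeft_snd, ← hh.1,
            evalPair_whiskerLeft_comp]
        · rw [map_evalPair, map_map, whiskerLeft_fst, whiskerLeft_snd, ← hh.2,
            evalPair_whiskerLeft_comp]
      refine hom_ext_evalPair fun x p s ↦ ?_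
      rw [evalPair_homOfEvalPair, ← e, map_evalPair, map_map, lift_fst, lift_snd, op_id,
        CategoryTheory.Functor.map_id, ConcreteCategory.id_apply]
  exact ⟨BinaryCofan.isColimitMk (fun s ↦ (key s.inl s.inr).choose)
    (fun s ↦ (key s.inl s.inr).choose_spec.1.1) (fun s ↦ (key s.inl s.inr).choose_spec.1.2)
    (fun s m h₁ h₂ ↦ (key s.inl s.inr).choose_spec.2 m ⟨h₁, h₂⟩)⟩

end Coproducts

/-- A functor preserves binary coproducts if it preserves the chosen ones. -/
theorem preservesColimitsOfShape_pair_of_coprod {D E : Type*} [Category* D] [Category* E]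
    [HasBinaryCoproducts D] (F : D ⥤ E)
    (h : ∀ a b : D, Nonempty (IsColimit (BinaryCofan.mk
      (F.map (coprod.inl : a ⟶ a ⨿ b)) (F.map (coprod.inr : b ⟶ a ⨿ b))))) :
    PreservesColimitsOfShape (Discrete WalkingPair) F where
  preservesColimit {K} := by
    have (a b : D) : PreservesColimit (pair a b) F :=
      preservesColimit_of_preserves_colimit_cocone (coprodIsCoprod a b)
        ((isColimitMapCoconeBinaryCofanEquiv F _ _).symm (h a b).some)
    exact preservesColimit_of_iso_diagram F (diagramIsoPair K).symm

/-! ### Distributivity and cartesian closure -/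

section Distributivity

variable {C : Type u} [SmallCategory C] [HasFiniteCoproducts C]

theorem preservesBinaryCoproducts_yo_tensorLeft
    (h : ∀ (P : PPPsh C) (a b : C), Nonempty (IsColimit (BinaryCofan.mk
      (P ◁ (yo C).map (coprod.inl : a ⟶ a ⨿ b)) (P ◁ (yo C).map (coprod.inr : b ⟶ a ⨿ b)))))
    (P : PPPsh C) :
    PreservesColimitsOfShape (Discrete WalkingPair) (yo C ⋙ tensorLeft P) :=
  preservesColimitsOfShape_pair_of_coprod _ (h P)

/-- If `P × -` preserves the binary coproducts of representables, it preserves the nullary one: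
both coprojections of `0 + 0` agree, so `P × y(0)` has at most one morphism to any object. -/
theorem preservesFiniteCoproducts_yo_tensorLeft
    (h : ∀ (P : PPPsh C) (a b : C), Nonempty (IsColimit (BinaryCofan.mk
      (P ◁ (yo C).map (coprod.inl : a ⟶ a ⨿ b)) (P ◁ (yo C).map (coprod.inr : b ⟶ a ⨿ b)))))
    (P : PPPsh C) :
    PreservesFiniteCoproducts (yo C ⋙ tensorLeft P) := by
  have := preservesBinaryCoproducts_yo_tensorLeft h P
  have hi : IsInitial ((yo C ⋙ tensorLeft P).obj (⊥_ C)) := by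
    refine IsInitial.ofUniqueHom
      (fun Q ↦ snd P ((yo C).obj (⊥_ C)) ≫ (exists_hom_yo_of_isInitial initialIsInitial Q).some)
      fun Q f ↦ ?_
    have key {f g : P ⊗ (yo C).obj (⊥_ C) ⟶ Q} : f = g := by
      obtain ⟨k, hf, hg⟩ := BinaryCofan.IsColimit.desc' (h P (⊥_ C) (⊥_ C)).some f g
      rw [← hf, ← hg]
      dsimp
      rw [initialIsInitial.hom_ext coprod.inl coprod.inr]
    exact key
  have := hi.hasInitial
  have : PreservesColimit (Functor.empty.{0} C) (yo C ⋙ tensorLeft P) :=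
    preservesInitial_of_iso _ (initialIsoIsInitial hi)
  have : PreservesColimitsOfShape (Discrete PEmpty.{1}) (yo C ⋙ tensorLeft P) :=
    preservesColimitsOfShape_pempty_of_preservesInitial _
  exact ⟨fun n ↦ PreservesFiniteCoproducts.of_preserves_binary_and_initial _ (Fin n)⟩

/-- The internal hom of presheaves between product-preserving presheaves preserves products. -/
theorem productPreserving_ihom
    (h : ∀ (P : PPPsh C) (a b : C), Nonempty (IsColimit (BinaryCofan.mk
      (P ◁ (yo C).map (coprod.inl : a ⟶ a ⨿ b)) (P ◁ (yo C).map (coprod.inr : b ⟶ a ⨿ b)))))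
    (P Q : PPPsh C) :
    productPreserving C ((ihom P.obj).obj Q.obj) := by
  have := preservesFiniteCoproducts_yo_tensorLeft h P
  have := preservesFiniteProducts_op (yo C ⋙ tensorLeft P)
  -- This functor is `c ↦ Hom(P × y(c), Q)`; currying and Yoneda identify it with the internal hom.
  have : PreservesFiniteProducts ((yo C ⋙ tensorLeft P).op ⋙ yoneda.obj Q) :=
    comp_preservesFiniteProducts _ _
  let e : (yo C ⋙ tensorLeft P).op ⋙ yoneda.obj Q ≅ (ihom P.obj).obj Q.obj :=
    NatIso.ofComponents (fun c ↦
      (((productPreserving C).fullyFaithfulι.homEquiv (X := P ⊗ (yo C).obj c.unop) (Y := Q)).trans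
        (((ihom.adjunction P.obj).homEquiv (yoneda.obj c.unop) Q.obj).trans
          yonedaEquiv)).toIso)
      (fun {c d} k ↦ by
        ext f
        refine Eq.trans ?_ (yonedaEquiv_naturality
          ((ihom.adjunction P.obj).homEquiv (yoneda.obj c.unop) Q.obj f.hom) k.unop).symm
        exact congrArg yonedaEquiv
          ((ihom.adjunction P.obj).homEquiv_naturality_left (yoneda.map k.unop) f.hom))
  exact ⟨fun n ↦ preservesLimitsOfShape_of_natIso e⟩

/-- The inclusion into presheaves is fully faithful and commutes with `P × -` and with the internal
hom, so the adjunction restricts. -/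
theorem nonempty_monoidalClosed
    (h : ∀ (P : PPPsh C) (a b : C), Nonempty (IsColimit (BinaryCofan.mk
      (P ◁ (yo C).map (coprod.inl : a ⟶ a ⨿ b)) (P ◁ (yo C).map (coprod.inr : b ⟶ a ⨿ b))))) :
    Nonempty (MonoidalClosed (PPPsh C)) :=
  ⟨{ closed P :=
      { rightAdj := (productPreserving C).lift ((productPreserving C).ι ⋙ ihom P.obj)
          (productPreserving_ihom h P)
        adj := (ihom.adjunction P.obj).restrictFullyFaithful
          (productPreserving C).fullyFaithfulι (productPreserving C).fullyFaithfulι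
          (Iso.refl _) (Iso.refl _) } }⟩

/-- Since `y(x × -) ≅ y(x) × y(-)` preserves binary coproducts and the fully faithful `y` reflects
them, `x × -` preserves them. -/
theorem isCartesianDistributive_of_yo [CartesianMonoidalCategory C]
    (h : ∀ (P : PPPsh C) (a b : C), Nonempty (IsColimit (BinaryCofan.mk
      (P ◁ (yo C).map (coprod.inl : a ⟶ a ⨿ b)) (P ◁ (yo C).map (coprod.inr : b ⟶ a ⨿ b))))) :
    IsCartesianDistributive C := by
  have : IsMonoidalLeftDistrib C := ⟨fun x ↦ by
    have := preservesBinaryCoproducts_yo_tensorLeft h ((yo C).obj x)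
    have : PreservesColimitsOfShape (Discrete WalkingPair) (tensorLeft x ⋙ yo C) :=
      preservesColimitsOfShape_of_natIso (CartesianMonoidalCategory.prodComparisonNatIso (yo C) x).symm
    have e : yo C ⋙ (productPreserving C).ι ≅ yoneda := Iso.refl _
    have : (yo C).Full := Functor.Full.of_comp_faithful_iso e
    have : (yo C).Faithful := Functor.Faithful.of_comp_iso e
    exact preservesColimitsOfShape_of_reflects_of_preserves (tensorLeft x) (yo C)⟩
  exact IsCartesianDistributive.of_isMonoidalLeftDistrib C

end Distributivity

/-! ### Exponentials of representables -/

section Exponentials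

variable {C : Type u} [SmallCategory C]

/-- The value of a morphism into a representable presheaf. -/
def yoApp {X : PPPsh C} {e : C} (γ : X ⟶ (yo C).obj e) {x : C} (p : X.obj.obj (op x)) : x ⟶ e :=
  γ.hom.app (op x) p

theorem comp_yoApp {X : PPPsh C} {e : C} (γ : X ⟶ (yo C).obj e) {x y : C} (k : y ⟶ x)
    (p : X.obj.obj (op x)) : k ≫ yoApp γ p = yoApp γ (X.obj.map k.op p) :=
  (NatTrans.naturality_apply γ.hom k.op p).symm

/-- An element of `y(a) × X`. -/
def yoPair {X : PPPsh C} {a x : C} (s : x ⟶ a) (p : X.obj.obj (op x)) :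
    ((yo C).obj a ⊗ X).obj.obj (op x) :=
  (s, p)

theorem yoApp_ext {X : PPPsh C} {e : C} {γ δ : X ⟶ (yo C).obj e}
    (h : ∀ ⦃x : C⦄ (p : X.obj.obj (op x)), yoApp γ p = yoApp δ p) : γ = δ := by
  refine InducedCategory.hom_ext (NatTrans.ext (funext fun x ↦ ?_))
  ext p
  exact h (x := x.unop) p

/-- A morphism into a representable presheaf from its values. -/
def homOfYoApp {X : PPPsh C} {e : C} (φ : ∀ ⦃x : C⦄, X.obj.obj (op x) → (x ⟶ e))
    (hφ : ∀ ⦃x y : C⦄ (k : y ⟶ x) (p : X.obj.obj (op x)), k ≫ φ p = φ (X.obj.map k.op p)) :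
    X ⟶ (yo C).obj e :=
  ObjectProperty.homMk
    { app x := ↾fun p ↦ φ (x := x.unop) p
      naturality x y k := by
        ext p
        exact (hφ k.unop p).symm }

variable [CartesianMonoidalCategory C]

theorem yoApp_prodComparisonIso_inv_comp {a e b : C} (ev : a ⊗ e ⟶ b) {x : C}
    (s : x ⟶ a) (t : x ⟶ e) :
    yoApp ((prodComparisonIso (yo C) a e).inv ≫ (yo C).map ev)
      (yoPair (X := (yo C).obj e) s t) = lift s t ≫ ev := by
  have h : yoApp ((prodComparisonIso (yo C) a e).hom ≫ (prodComparisonIso (yo C) a e).inv ≫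
      (yo C).map ev) (lift s t) = lift s t ≫ ev := by
    rw [Iso.hom_inv_id_assoc]
    rfl
  have h' : (prodComparisonIso (yo C) a e).hom.hom.app (op x) (lift s t) =
      yoPair (X := (yo C).obj e) s t :=
    Prod.ext (lift_fst s t) (lift_snd s t)
  rw [← h, ← h']
  rfl

/-- The Yoneda embedding into product-preserving presheaves preserves exponentials. -/
theorem preservesExponentials_yo : PreservesExponentials (yo C) := by
  intro a b e ev hev X f
  let φ {x : C} (s : x ⟶ a) (p : X.obj.obj (op x)) : x ⟶ b := yoApp f (yoPair s p)
  have hφ {x y : C} (k : y ⟶ x) (s : x ⟶ a) (p : X.obj.obj (op x)) :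
      k ≫ φ s p = φ (k ≫ s) (X.obj.map k.op p) := comp_yoApp f k (yoPair s p)
  have map_map {x y z : C} (k : y ⟶ x) (l : z ⟶ y) (p : X.obj.obj (op x)) :
      X.obj.map l.op (X.obj.map k.op p) = X.obj.map (l ≫ k).op p := by simp
  -- Transposing the value of `f` at the generic pair over `a × x` gives the only possible value `g
  -- x p : x ⟶ e` at `p`.
  have exp (x : C) (p : X.obj.obj (op x)) := hev (φ (fst a x) (X.obj.map (snd a x).op p))
  choose g hg hu using exp
  have hom_ext_iff (γ : X ⟶ (yo C).obj e) :
      (yo C).obj a ◁ γ ≫ (prodComparisonIso (yo C) a e).inv ≫ (yo C).map ev = f ↔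
        ∀ (x : C) (s : x ⟶ a) (p : X.obj.obj (op x)), lift s (yoApp γ p) ≫ ev = φ s p := by
    have h₀ (x : C) (s : x ⟶ a) (p : X.obj.obj (op x)) :
        yoApp ((yo C).obj a ◁ γ ≫ (prodComparisonIso (yo C) a e).inv ≫ (yo C).map ev)
          (yoPair s p) = lift s (yoApp γ p) ≫ ev :=
      yoApp_prodComparisonIso_inv_comp ev s (yoApp γ p)
    refine ⟨fun h x s p ↦ ?_, fun h ↦ yoApp_ext fun x t ↦ (h₀ x t.1 t.2).trans (h x t.1 t.2)⟩
    rw [← h₀, h]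
  simp only [hom_ext_iff]
  refine ⟨homOfYoApp g fun x y k p ↦ hu _ _ _ ?_, fun x s p ↦ ?_, fun γ h ↦
    yoApp_ext fun x p ↦ hu _ _ _ ?_⟩
  · beta_reduce
    rw [MonoidalCategory.whiskerLeft_comp, Category.assoc, hg, hφ, map_map, map_map,
      whiskerLeft_fst, whiskerLeft_snd]
  · have e' : lift s (g x p) = lift s (𝟙 x) ≫ a ◁ g x p := by simp
    refine (congrArg (· ≫ ev) e').trans ?_
    rw [Category.assoc, hg, hφ, map_map, lift_fst, lift_snd, op_id, CategoryTheory.Functor.map_id,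
      ConcreteCategory.id_apply]
  · have e' : a ◁ yoApp γ p = lift (fst a x) (snd a x ≫ yoApp γ p) := by ext <;> simp
    beta_reduce at h ⊢
    rw [e', comp_yoApp, h]

end Exponentials

end SiftedCCC

theorem mainTheorem7 (C : Type u) [SmallCategory C] [CartesianMonoidalCategory C]
    [HasFiniteCoproducts C] :
    siftedCompletion C = productPreserving C ∧
    List.TFAE [
      IsCartesianDistributive C,
      ∀ (P : PPPsh C) (a b : C), Nonempty (IsColimit (BinaryCofan.mk
        (P ◁ (yo C).map (coprod.inl : a ⟶ a ⨿ b)) (P ◁ (yo C).map (coprod.inr : b ⟶ a ⨿ b)))),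
      Nonempty (MonoidalClosed (PPPsh C))] ∧
    (IsCartesianDistributive C → PreservesExponentials (yo C)) := by
  refine ⟨funext fun P ↦ propext
    ⟨productPreserving_of_siftedCompletion, siftedCompletion_of_productPreserving⟩,
    ?_, fun _ ↦ preservesExponentials_yo⟩
  tfae_have 1 → 2 := fun h P a b ↦ isColimit_whiskerLeft_yo
    (fun x ↦ ⟨mapIsColimitOfPreservesOfIsColimit (tensorLeft x) _ _ (coprodIsCoprod a b)⟩) P
  tfae_have 2 → 3 := nonempty_monoidalClosed
  tfae_have 2 → 1 := fun h ↦ isCartesianDistributive_of_yo h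
  -- The left adjoint `P × -` preserves the coproduct `y(a+b)` of `y(a)` and `y(b)`.
  tfae_have 3 → 2 := fun ⟨h⟩ P a b ↦
    ⟨mapIsColimitOfPreservesOfIsColimit (tensorLeft P) _ _ (isColimit_yo (coprodIsCoprod a b)).some⟩
  tfae_finish
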